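/- Consider the $K$-user XPM (cross-phase modulation) interference channel: in a block of length $n$ user $k\in\{1,\dots,K\}$ sends $X_k[1],\dots,X_k[n]\in\mathbb{C}$ and its receiver observes $$Y_k[i]=X_k[i]\Bigl(1+\jmath\sum_{m=-M}^{M}\sum_{w\ne k}c_{k,w}^m\,|X_w[i-m]|^2\Bigr)+N_k[i],\qquad 1\le i\le n,$$ with the convention $X_w[j]=0$ for $j<1$ or $j>n$. Here $M\ge 0$ is an integer, the coefficients $c_{k,w}^m$ ($w\ne k$, $|m|\le M$) are nonnegative reals, and for each $k$ the noise $N_k[1],\dots,N_k[n]$ is i.i.d. circularly symmetric complex Gaussian with mean zero and variance $\sigma_k^2>0$ per real dimension (so $\mathbb{E}|N_k[i]|^2=2\sigma_k^2$); the noises of different users may be dependent in any way. Codewords obey the peak power constraints $\max_{1\le i\le n}|x_k[i]|^2\le P_k$, where $P_k\ge 0$. An $(n,2^{nR_1},\dots,2^{nR_K})$ code, for rates $R_k\ge 0$, consists of message sets $\{1,\dots,\lfloor 2^{nR_k}\rfloor\}$, one encoder per user mapping each message of the user to a codeword of length $n$, and one decoder per user mapping $Y_k^n=(Y_k[1],\dots,Y_k[n])$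 to an estimate $\hat M_k$ or an error symbol. The messages $M_1,\dots,M_K$ are uniformly distributed and independent of each other and of the noise, and $P_e=\Pr\{(\hat M_1,\dots,\hat M_K)\ne(M_1,\dots,M_K)\}$. The tuple $(R_1,\dots,R_K)$ is achievable if there is a sequence of such codes, one for each $n$, with $P_e\to 0$ as $n\to\infty$; the capacity region $\mathcal{C}_K$ is the closure of the set of achievable tuples. Then every achievable rate tuple, and hence every $(R_1,\dots,R_K)\in\mathcal{C}_K$, satisfies, for every $k\in\{1,\dots,K\}$, $$R_k\le U_k:=\log_2\Biggl(1+\frac{P_k}{2\sigma_k^2}\Bigl(1+\Bigl(\sum_{w\ne k}P_w\sum_{m=-M}^{M}c_{k,w}^m\Bigr)^2\Bigr)\Biggr).$$ That is, $\mathcal{C}_{\mathrm{out}}=\{(R_1,\dots,R_K): R_k\le U_k\ \forall k\}$ is an outer bound on $\mathcal{C}_K$. -/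

import Mathlib

open MeasureTheory ProbabilityTheory Filter Topology

noncomputable section

/-- Parameters of the `K`-user XPM interference channel: one-sided memory `M`, peak powers `P k`,
noise standard deviations `σ k` (per real dimension) and coefficients `c k w m` with which
interferer `w` at lag `m` acts on user `k`. Only `c k w m` with `w ≠ k` and `-M ≤ m ≤ M` is ever
used. -/
structure XPMChannel (K : ℕ) where
  M : ℕ
  P : Fin K → ℝ
  σ : Fin K → ℝ
  c : Fin K → Fin K → ℤ → ℝ

/-- The law of a circularly symmetric complex Gaussian variable with mean zero and
variance `σ ^ 2` per real dimension: real and imaginary part are independent `N(0, σ ^ 2)`. -/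
def complexGaussian (σ : ℝ) : Measure ℂ :=
  ((gaussianReal 0 (Real.toNNReal (σ ^ 2))).prod (gaussianReal 0 (Real.toNNReal (σ ^ 2)))).map
    (fun p : ℝ × ℝ => (⟨p.1, p.2⟩ : ℂ))

/-- `N n` is the joint law of the noise of all users over a block of length `n`: the noise of each
user `k` is i.i.d. in time and complex Gaussian with variance `σ k ^ 2` per real dimension.
The dependence between the noises of different users is arbitrary. -/
def IsGaussianNoise {K : ℕ} (σ : Fin K → ℝ) (N : ∀ n : ℕ, Measure (Fin K → Fin n → ℂ)) : Prop :=
  ∀ n, IsProbabilityMeasure (N n) ∧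
    ∀ k, (N n).map (fun z => z k) = Measure.pi (fun _ : Fin n => complexGaussian (σ k))

/-- Extension of a block of `n` symbols to all integer times by zero. Times are counted from `0`,
so that the block occupies the times `0, …, n - 1`. -/
def extendZero {n : ℕ} (x : Fin n → ℂ) (j : ℤ) : ℂ :=
  if h : 0 ≤ j ∧ j < n then x ⟨j.toNat, by omega⟩ else 0

namespace XPMChannel

variable {K : ℕ} (ch : XPMChannel K)

/-- The total interference power
`∑_{m ∈ {-M, …, M}} ∑_{w ≠ k} c_{k,w}^m |x_w[i - m]|²` seen by user `k` at time `i`. -/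
def interference {n : ℕ} (x : Fin K → Fin n → ℂ) (k : Fin K) (i : Fin n) : ℝ :=
  ∑ m ∈ Finset.Icc (-(ch.M : ℤ)) ch.M, ∑ w ∈ Finset.univ.erase k,
    ch.c k w m * ‖extendZero (x w) ((i : ℤ) - m)‖ ^ 2

/-- The block received by user `k` when the users send the blocks `x` and the noise is `z`:
`y_k[i] = x_k[i] (1 + j ∑_m ∑_{w ≠ k} c_{k,w}^m |x_w[i - m]|²) + z_k[i]`. -/
def output {n : ℕ} (x z : Fin K → Fin n → ℂ) (k : Fin K) (i : Fin n) : ℂ :=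
  x k i * (1 + Complex.I * (ch.interference x k i : ℂ)) + z k i

/-- A code of block length `n` with `L k` messages for user `k`: deterministic encoders whose
codewords all obey the peak power constraints, and separate decoders, each of which
maps the block received by its user to a message or to an error symbol `none`. -/
structure Code (n : ℕ) (L : Fin K → ℕ) where
  encode : ∀ k, Fin (L k) → Fin n → ℂ
  peak_power : ∀ k m i, ‖encode k m i‖ ^ 2 ≤ ch.P k
  decode : ∀ k, (Fin n → ℂ) → Option (Fin (L k))
  measurable_decode : ∀ k m, MeasurableSet {y | decode k y = some m}

variable {ch} in
/-- The blocks sent by the users for the tuple of messages `m`. -/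
def Code.input {n : ℕ} {L : Fin K → ℕ} (C : ch.Code n L) (m : ∀ k, Fin (L k)) :
    Fin K → Fin n → ℂ :=
  fun k => C.encode k (m k)

variable {ch} in
/-- Probability, under the noise law `ν`, that at least one user's estimate is wrong, when the
messages are independent of each other and of the noise and uniformly distributed. -/
def Code.errorProb {n : ℕ} {L : Fin K → ℕ} (C : ch.Code n L)
    (ν : Measure (Fin K → Fin n → ℂ)) : ℝ :=
  (∑ m : (∀ k, Fin (L k)),
      ν.real {z | ∃ k, C.decode k (ch.output (C.input m) z k) ≠ some (m k)}) /
    Fintype.card (∀ k, Fin (L k))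

/-- The sizes of the message sets `{1, 2, …, 2 ^ (n R_k)}`, i.e. the sets of the integers `m` with
`1 ≤ m ≤ 2 ^ (n R_k)`. -/
def messageCount (R : Fin K → ℝ) (n : ℕ) (k : Fin K) : ℕ :=
  ⌊(2 : ℝ) ^ ((n : ℝ) * R k)⌋₊

/-- A tuple of (nonnegative) rates is achievable if some sequence of codes at these rates has
error probability tending to zero. -/
def Achievable (N : ∀ n : ℕ, Measure (Fin K → Fin n → ℂ)) (R : Fin K → ℝ) : Prop :=
  (∀ k, 0 ≤ R k) ∧
    ∃ C : ∀ n : ℕ, ch.Code n (messageCount R n),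
      Tendsto (fun n => (C n).errorProb (N n)) atTop (𝓝 0)

/-- The capacity region: the closure of the set of achievable rate tuples. -/
def capacityRegion (N : ∀ n : ℕ, Measure (Fin K → Fin n → ℂ)) : Set (Fin K → ℝ) :=
  closure {R | ch.Achievable N R}

/-- An outer bound to the capacity region: a set that contains every achievable rate tuple. -/
def IsOuterBound (N : ∀ n : ℕ, Measure (Fin K → Fin n → ℂ)) (S : Set (Fin K → ℝ)) : Prop :=
  ∀ R, ch.Achievable N R → R ∈ S

/-- `U_k`, in bits per channel use. -/
def upperBound (k : Fin K) : ℝ :=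
  Real.logb 2 (1 + ch.P k / (2 * ch.σ k ^ 2) *
    (1 + (∑ w ∈ Finset.univ.erase k,
      ch.P w * ∑ m ∈ Finset.Icc (-(ch.M : ℤ)) ch.M, ch.c k w m) ^ 2))

/-- The set of rate tuples with `R_k ≤ U_k` for every user `k`. -/
def outerRegion : Set (Fin K → ℝ) :=
  {R | ∀ k, R k ≤ ch.upperBound k}

end XPMChannel

end

open MeasureTheory ProbabilityTheory Filter Topology

noncomputable section

/-! Fix all messages. User `k` then receives Gaussian noise shifted by a fixed block, and since `|1
+ j t|² = 1 + t²`, each entry of that block has power at most `S = P_k (1 + I²)`, where `I` is the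
largest possible interference. So a converse for one Gaussian channel of peak power `S` suffices.

That converse is a change of measure rather than Fano's inequality. The output law is compared with
i.i.d. complex Gaussians of variance `σ² + S/2` per real dimension, a reference law independent of
the messages; the relative entropy is at most `n log (1 + S/(2σ²))`. By `measureReal_mul_log_le`,
the probability of correct decoding times `log L` exceeds this by at most `(L - 1)` times the
reference mass of the decoding region. The `L` regions are disjoint, so averaging over messages
bounds the excess by `1`. Dividing by `n` gives the rate bound, and closedness of the region extends
it to limits. -/

/-! ### Change of measure and product densities. -/

/-- **Change of measure bound.** If `ν` has density `exp (-ℓ)` with respect to the probability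
measure `μ`, then the `μ`-probability of a set is controlled by its `ν`-probability and the
relative entropy `∫ ℓ ∂μ`. -/
lemma measureReal_mul_log_le {α : Type*} [MeasurableSpace α] {μ ν : Measure α}
    [IsProbabilityMeasure μ] [IsProbabilityMeasure ν] {ℓ : α → ℝ} (hℓm : Measurable ℓ)
    (hℓ : Integrable ℓ μ) (hν : μ.withDensity (fun x => ENNReal.ofReal (Real.exp (-ℓ x))) = ν)
    {A : Set α} (hA : MeasurableSet A) {L : ℝ} (hL : 1 ≤ L) :
    μ.real A * Real.log L ≤ ∫ x, ℓ x ∂μ + (L - 1) * ν.real A := by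
  have hfm : Measurable fun x => Real.exp (-ℓ x) := Real.measurable_exp.comp hℓm.neg
  have hlin (B : Set α) (hB : MeasurableSet B) :
      ∫⁻ x in B, ENNReal.ofReal (Real.exp (-ℓ x)) ∂μ = ν B := by
    rw [← hν, withDensity_apply _ hB]
  have hint : Integrable (fun x => Real.exp (-ℓ x)) μ := by
    refine ⟨hfm.aestronglyMeasurable, ?_⟩
    rw [hasFiniteIntegral_iff_ofReal (ae_of_all _ fun x => (Real.exp_pos _).le),
      ← setLIntegral_univ, hlin _ MeasurableSet.univ]
    exact measure_lt_top _ _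
  have hset (B : Set α) (hB : MeasurableSet B) : ∫ x in B, Real.exp (-ℓ x) ∂μ = ν.real B := by
    rw [integral_eq_lintegral_of_nonneg_ae (ae_of_all _ fun x => (Real.exp_pos _).le)
      hfm.aestronglyMeasurable, hlin B hB, measureReal_def]
  have hone : ∫ x, Real.exp (-ℓ x) ∂μ = 1 := by
    rw [← setIntegral_univ, hset _ MeasurableSet.univ, probReal_univ]
  -- This is `1 + t ≤ exp t`, with `t = log L - ℓ` on `A` and `t = -ℓ` off `A`; integrating it gives
  -- the claim.
  have hpt (x : α) : A.indicator (fun _ => Real.log L) x - ℓ x ≤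
      Real.exp (-ℓ x) + (L - 1) * A.indicator (fun x => Real.exp (-ℓ x)) x - 1 := by
    by_cases hx : x ∈ A
    · have h := Real.add_one_le_exp (Real.log L - ℓ x)
      rw [sub_eq_add_neg (Real.log L), Real.exp_add, Real.exp_log (by linarith)] at h
      simp only [Set.indicator_of_mem hx]
      linarith
    · have h := Real.add_one_le_exp (-ℓ x)
      simp only [Set.indicator_of_notMem hx]
      linarith
  have hI1 : Integrable (A.indicator fun _ => Real.log L) μ := (integrable_const _).indicator hA
  have hI2 : Integrable (A.indicator fun x => Real.exp (-ℓ x)) μ := hint.indicator hA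
  have hI3 : Integrable (fun x => Real.exp (-ℓ x) +
      (L - 1) * A.indicator (fun x => Real.exp (-ℓ x)) x) μ := hint.add (hI2.const_mul (L - 1))
  have h : ∫ x, (A.indicator (fun _ => Real.log L) x - ℓ x) ∂μ ≤ ∫ x, (Real.exp (-ℓ x) +
      (L - 1) * A.indicator (fun x => Real.exp (-ℓ x)) x - 1) ∂μ :=
    integral_mono (hI1.sub hℓ) (hI3.sub (integrable_const (1 : ℝ))) hpt
  rw [integral_sub hI1 hℓ, integral_sub hI3 (integrable_const _),
    integral_add hint (hI2.const_mul _), integral_const_mul, integral_indicator hA,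
    integral_indicator hA, hone, hset A hA, setIntegral_const] at h
  simp only [smul_eq_mul, integral_const, probReal_univ] at h
  linarith

/-- A product of measures with densities with respect to probability measures. -/
lemma pi_withDensity {ι : Type*} [Fintype ι] {X : ι → Type*} [∀ i, MeasurableSpace (X i)]
    (μ : ∀ i, Measure (X i)) [∀ i, IsProbabilityMeasure (μ i)] {f : ∀ i, X i → ENNReal}
    (hf : ∀ i, Measurable (f i)) [∀ i, SigmaFinite ((μ i).withDensity (f i))] :
    (Measure.pi μ).withDensity (fun x => ∏ i, f i (x i)) =
      Measure.pi fun i => (μ i).withDensity (f i) := by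
  refine (Measure.pi_eq fun s hs => ?_).symm
  rw [withDensity_apply _ (MeasurableSet.univ_pi hs),
    ← lintegral_indicator (MeasurableSet.univ_pi hs)]
  have hm (i : ι) : Measurable ((s i).indicator (f i)) := (hf i).indicator (hs i)
  have hprod (x : ∀ i, X i) : (Set.univ.pi s).indicator (fun x => ∏ i, f i (x i)) x =
      ∏ i, (s i).indicator (f i) (x i) := by
    by_cases hx : x ∈ Set.univ.pi s
    · rw [Set.indicator_of_mem hx]
      exact Finset.prod_congr rfl fun i _ => (Set.indicator_of_mem (hx i trivial) _).symm
    · rw [Set.indicator_of_notMem hx]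
      obtain ⟨i, hi⟩ : ∃ i, x i ∉ s i := by simpa [Set.mem_pi] using hx
      exact (Finset.prod_eq_zero (Finset.mem_univ i) (Set.indicator_of_notMem hi _)).symm
  simp_rw [hprod]
  rw [lintegral_prod_eq_prod_lintegral_of_indepFun Finset.univ
    (fun i (x : ∀ i, X i) => (s i).indicator (f i) (x i))
    (iIndepFun_pi fun i => (hm i).aemeasurable)
    fun i => (hm i).comp (measurable_pi_apply i)]
  refine Finset.prod_congr rfl fun i _ => ?_
  rw [withDensity_apply _ (hs i), ← lintegral_indicator (hs i),
    ← (measurePreserving_eval μ i).lintegral_comp (hm i)]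

/-! ### Complex Gaussian laws: densities, likelihood ratios, second moments. -/

instance isProbabilityMeasure_complexGaussian (σ : ℝ) :
    IsProbabilityMeasure (complexGaussian σ) :=
  Measure.isProbabilityMeasure_map Complex.measurableEquivRealProd.symm.measurable.aemeasurable

lemma complexGaussian_eq_withDensity {σ : ℝ} (hσ : 0 < σ) :
    complexGaussian σ = volume.withDensity (fun z : ℂ =>
      ENNReal.ofReal ((2 * Real.pi * σ ^ 2)⁻¹ * Real.exp (-‖z‖ ^ 2 / (2 * σ ^ 2)))) := by
  have hv : Real.toNNReal (σ ^ 2) ≠ 0 := by simpa using hσ.ne'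
  have hmap : (fun p : ℝ × ℝ => (⟨p.1, p.2⟩ : ℂ)) = Complex.measurableEquivRealProd.symm := rfl
  rw [complexGaussian, gaussianReal_of_var_ne_zero _ hv,
    prod_withDensity (measurable_gaussianPDF _ _) (measurable_gaussianPDF _ _), hmap]
  refine Measure.ext fun s hs => ?_
  rw [MeasurableEquiv.map_apply, withDensity_apply _ hs,
    withDensity_apply _ (Complex.measurableEquivRealProd.symm.measurable hs),
    ← (Complex.volume_preserving_equiv_real_prod.symm).setLIntegral_comp_preimage_emb
      Complex.measurableEquivRealProd.symm.measurableEmbedding]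
  refine lintegral_congr fun p => ?_
  rw [gaussianPDF, gaussianPDF, ← ENNReal.ofReal_mul (gaussianPDFReal_nonneg _ _ _)]
  congr 1
  simp only [gaussianPDFReal, Real.coe_toNNReal _ (sq_nonneg σ), sub_zero]
  have hn : ‖Complex.measurableEquivRealProd.symm p‖ ^ 2 = p.1 ^ 2 + p.2 ^ 2 := by
    rw [← Complex.normSq_eq_norm_sq, Complex.normSq_apply, ← hmap]
    ring
  have hsq : √(2 * Real.pi * σ ^ 2) * √(2 * Real.pi * σ ^ 2) = 2 * Real.pi * σ ^ 2 :=
    Real.mul_self_sqrt (by positivity)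
  rw [hn, mul_mul_mul_comm, ← mul_inv, hsq, ← Real.exp_add]
  congr 2
  ring

/-- The log-likelihood ratio of `complexGaussian σ` shifted by `u` to `complexGaussian τ`, at
the point `u + z`. -/
def gaussianLLR (σ τ : ℝ) (u z : ℂ) : ℝ :=
  Real.log (τ ^ 2 / σ ^ 2) + ‖u + z‖ ^ 2 / (2 * τ ^ 2) - ‖z‖ ^ 2 / (2 * σ ^ 2)

lemma measurable_gaussianLLR (σ τ : ℝ) (u : ℂ) : Measurable (gaussianLLR σ τ u) := by
  unfold gaussianLLR
  fun_prop

/-- The factor turns the `σ`-density at `z` into the `τ`-density at `u + z`, and Lebesgue measure is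
translation invariant. Working at the noise point `z` keeps the base measure free of `u`. -/
lemma withDensity_exp_neg_gaussianLLR {σ τ : ℝ} (hσ : 0 < σ) (hτ : 0 < τ) (u : ℂ) :
    (complexGaussian σ).withDensity (fun z => ENNReal.ofReal (Real.exp (-gaussianLLR σ τ u z))) =
      (complexGaussian τ).map (fun y => -u + y) := by
  have hshift : MeasurePreserving (fun y : ℂ => -u + y) volume volume :=
    measurePreserving_add_left _ _
  refine Measure.ext fun s hs => ?_
  have hs' : MeasurableSet ((fun y : ℂ => -u + y) ⁻¹' s) := hshift.measurable hs
  rw [Measure.map_apply hshift.measurable hs, complexGaussian_eq_withDensity hσ,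
    complexGaussian_eq_withDensity hτ, withDensity_apply _ hs',
    ← withDensity_mul _ (by fun_prop) (by have := measurable_gaussianLLR σ τ u; fun_prop),
    withDensity_apply _ hs, ← hshift.setLIntegral_comp_preimage_emb
      (MeasurableEquiv.addLeft (-u)).measurableEmbedding]
  refine lintegral_congr fun y => ?_
  simp only [Pi.mul_apply]
  rw [← ENNReal.ofReal_mul (by positivity)]
  congr 1
  rw [gaussianLLR, show u + (-u + y) = y by ring, mul_assoc, ← Real.exp_add,
    show -‖-u + y‖ ^ 2 / (2 * σ ^ 2) + -(Real.log (τ ^ 2 / σ ^ 2) + ‖y‖ ^ 2 / (2 * τ ^ 2) -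
      ‖-u + y‖ ^ 2 / (2 * σ ^ 2)) = -Real.log (τ ^ 2 / σ ^ 2) + -‖y‖ ^ 2 / (2 * τ ^ 2) by ring,
    Real.exp_add, Real.exp_neg, Real.exp_log (by positivity)]
  field_simp

lemma integral_sq_gaussianReal (v : NNReal) : ∫ x, x ^ 2 ∂gaussianReal 0 v = v := by
  have h := variance_id_gaussianReal (μ := 0) (v := v)
  rw [variance_eq_sub (memLp_id_gaussianReal' 2 (by simp))] at h
  simpa using h

lemma integrable_sq_gaussianReal (v : NNReal) :
    Integrable (fun x : ℝ => x ^ 2) (gaussianReal 0 v) :=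
  (memLp_id_gaussianReal (μ := 0) (v := v) 2).integrable_sq

lemma integrable_fun_id_gaussianReal (v : NNReal) :
    Integrable (fun x : ℝ => x) (gaussianReal 0 v) :=
  (memLp_id_gaussianReal (μ := 0) (v := v) 1).integrable le_rfl

lemma norm_add_sq_complex_mk (u : ℂ) (p : ℝ × ℝ) :
    ‖u + (⟨p.1, p.2⟩ : ℂ)‖ ^ 2 =
      ‖u‖ ^ 2 + (2 * u.re * p.1 + p.1 ^ 2) + (2 * u.im * p.2 + p.2 ^ 2) := by
  simp only [← Complex.normSq_eq_norm_sq, Complex.normSq_apply, Complex.add_re, Complex.add_im]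
  ring

lemma measurable_complex_mk : Measurable fun p : ℝ × ℝ => (⟨p.1, p.2⟩ : ℂ) :=
  Complex.measurableEquivRealProd.symm.measurable

lemma integrable_norm_add_sq_complexGaussian (σ : ℝ) (u : ℂ) :
    Integrable (fun z => ‖u + z‖ ^ 2) (complexGaussian σ) := by
  rw [complexGaussian, integrable_map_measure (by fun_prop) measurable_complex_mk.aemeasurable]
  simp only [Function.comp_def, norm_add_sq_complex_mk]
  exact ((integrable_const _).add ((((integrable_fun_id_gaussianReal _).const_mul _).add
    (integrable_sq_gaussianReal _)).comp_fst _)).add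
    ((((integrable_fun_id_gaussianReal _).const_mul _).add (integrable_sq_gaussianReal _)).comp_snd _)

lemma integral_norm_add_sq_complexGaussian (σ : ℝ) (u : ℂ) :
    ∫ z, ‖u + z‖ ^ 2 ∂complexGaussian σ = ‖u‖ ^ 2 + 2 * σ ^ 2 := by
  set γ := gaussianReal 0 (Real.toNNReal (σ ^ 2))
  have hI (a : ℝ) : Integrable (fun x : ℝ => 2 * a * x + x ^ 2) γ :=
    ((integrable_fun_id_gaussianReal _).const_mul _).add (integrable_sq_gaussianReal _)
  have hE (a : ℝ) : ∫ x, (2 * a * x + x ^ 2) ∂γ = σ ^ 2 := by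
    rw [integral_add ((integrable_fun_id_gaussianReal _).const_mul _) (integrable_sq_gaussianReal _),
      integral_const_mul, integral_id_gaussianReal, integral_sq_gaussianReal,
      Real.coe_toNNReal _ (sq_nonneg σ)]
    ring
  rw [complexGaussian, integral_map measurable_complex_mk.aemeasurable (by fun_prop)]
  simp only [norm_add_sq_complex_mk]
  have hfst : Integrable (fun p : ℝ × ℝ => ‖u‖ ^ 2 + (2 * u.re * p.1 + p.1 ^ 2)) (γ.prod γ) :=
    (integrable_const _).add ((hI _).comp_fst _)
  rw [integral_add hfst ((hI _).comp_snd _),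
    integral_add (integrable_const _) ((hI _).comp_fst _),
    integral_fun_fst (fun x => 2 * u.re * x + x ^ 2),
    integral_fun_snd (fun x => 2 * u.im * x + x ^ 2), hE, hE]
  simp
  ring

lemma integrable_gaussianLLR (σ τ : ℝ) (u : ℂ) :
    Integrable (gaussianLLR σ τ u) (complexGaussian σ) := by
  have h0 := integrable_norm_add_sq_complexGaussian σ 0
  simp only [zero_add] at h0
  exact ((integrable_const _).add ((integrable_norm_add_sq_complexGaussian σ u).div_const _)).sub
    (h0.div_const _)

lemma integral_gaussianLLR (σ τ : ℝ) (u : ℂ) :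
    ∫ z, gaussianLLR σ τ u z ∂complexGaussian σ =
      Real.log (τ ^ 2 / σ ^ 2) + (‖u‖ ^ 2 + 2 * σ ^ 2) / (2 * τ ^ 2) -
        2 * σ ^ 2 / (2 * σ ^ 2) := by
  have h0 := integrable_norm_add_sq_complexGaussian σ 0
  have e0 := integral_norm_add_sq_complexGaussian σ 0
  have hu := integrable_norm_add_sq_complexGaussian σ u
  simp only [zero_add] at h0 e0
  have hsum : Integrable (fun z => Real.log (τ ^ 2 / σ ^ 2) + ‖u + z‖ ^ 2 / (2 * τ ^ 2))
      (complexGaussian σ) := (integrable_const _).add (hu.div_const _)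
  unfold gaussianLLR
  rw [integral_sub hsum (h0.div_const _),
    integral_add (integrable_const _) (hu.div_const _), integral_div, integral_div, e0,
    integral_norm_add_sq_complexGaussian]
  simp

/-- The reference variance is chosen so that `2τ² = S + 2σ²`, the largest mean received power. The
two quadratic terms then contribute at most `1 - 1 = 0`, leaving only the logarithm. -/
lemma integral_gaussianLLR_le {σ S : ℝ} (hσ : 0 < σ) (hS : 0 ≤ S) {u : ℂ} (hu : ‖u‖ ^ 2 ≤ S) :
    ∫ z, gaussianLLR σ √(σ ^ 2 + S / 2) u z ∂complexGaussian σ ≤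
      Real.log (1 + S / (2 * σ ^ 2)) := by
  have hτ : 0 < σ ^ 2 + S / 2 := by positivity
  rw [integral_gaussianLLR, Real.sq_sqrt hτ.le, div_self (by positivity)]
  have h1 : (‖u‖ ^ 2 + 2 * σ ^ 2) / (2 * (σ ^ 2 + S / 2)) ≤ 1 := by
    rw [div_le_one (by positivity)]
    linarith
  have h2 : (σ ^ 2 + S / 2) / σ ^ 2 = 1 + S / (2 * σ ^ 2) := by field_simp
  rw [h2]
  linarith

/-! ### Converse for one codeword of a Gaussian channel. -/

/-- Decoding region bound for one codeword of a Gaussian channel with peak power constraint. -/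
lemma gaussian_codeword_bound {n : ℕ} {σ S : ℝ} (hσ : 0 < σ) (hS : 0 ≤ S) {u : Fin n → ℂ}
    (hu : ∀ i, ‖u i‖ ^ 2 ≤ S) {D : Set (Fin n → ℂ)} (hD : MeasurableSet D) {L : ℝ} (hL : 1 ≤ L) :
    (Measure.pi fun _ : Fin n => complexGaussian σ).real {z | (fun i => u i + z i) ∈ D} *
        Real.log L ≤
      n * Real.log (1 + S / (2 * σ ^ 2)) + (L - 1) *
        (Measure.pi fun _ : Fin n => complexGaussian √(σ ^ 2 + S / 2)).real D := by
  set τ := √(σ ^ 2 + S / 2)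
  have hτ : 0 < τ := Real.sqrt_pos.2 (by positivity)
  have hshift (i : Fin n) : Measurable fun y : ℂ => -u i + y := by fun_prop
  have hpm (i : Fin n) : IsProbabilityMeasure ((complexGaussian τ).map fun y => -u i + y) :=
    Measure.isProbabilityMeasure_map (hshift i).aemeasurable
  have hint (i : Fin n) : Integrable (fun z : Fin n → ℂ => gaussianLLR σ τ (u i) (z i))
      (Measure.pi fun _ => complexGaussian σ) :=
    integrable_comp_eval (integrable_gaussianLLR σ τ (u i))
  have hdens : (Measure.pi fun _ : Fin n => complexGaussian σ).withDensity
      (fun z => ENNReal.ofReal (Real.exp (-∑ i, gaussianLLR σ τ (u i) (z i)))) =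
      Measure.pi fun i => (complexGaussian τ).map fun y => -u i + y := by
    have hprod (z : Fin n → ℂ) :
        ENNReal.ofReal (Real.exp (-∑ i, gaussianLLR σ τ (u i) (z i))) =
          ∏ i, ENNReal.ofReal (Real.exp (-gaussianLLR σ τ (u i) (z i))) := by
      rw [← ENNReal.ofReal_prod_of_nonneg fun i _ => (Real.exp_pos _).le, ← Real.exp_sum,
        Finset.sum_neg_distrib]
    simp_rw [hprod]
    have hsf (i : Fin n) : SigmaFinite ((complexGaussian σ).withDensity
        (fun z => ENNReal.ofReal (Real.exp (-gaussianLLR σ τ (u i) z)))) := by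
      rw [withDensity_exp_neg_gaussianLLR hσ hτ]
      infer_instance
    rw [pi_withDensity (fun _ => complexGaussian σ)
      (f := fun i z => ENNReal.ofReal (Real.exp (-gaussianLLR σ τ (u i) z)))
      fun i => ((measurable_gaussianLLR σ τ (u i)).neg.exp).ennreal_ofReal]
    simp_rw [withDensity_exp_neg_gaussianLLR hσ hτ]
  have hmap : (Measure.pi fun i => (complexGaussian τ).map fun y => -u i + y) =
      (Measure.pi fun _ : Fin n => complexGaussian τ).map fun y i => -u i + y i :=
    (Measure.pi_map_pi fun i => (hshift i).aemeasurable).symm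
  have hA : MeasurableSet {z : Fin n → ℂ | (fun i => u i + z i) ∈ D} :=
    (measurable_pi_lambda _ fun i => by fun_prop) hD
  have h := measureReal_mul_log_le
    (ℓ := fun z : Fin n → ℂ => ∑ i, gaussianLLR σ τ (u i) (z i))
    (Finset.measurable_sum _ fun i _ =>
      (measurable_gaussianLLR σ τ (u i)).comp (measurable_pi_apply i))
    (integrable_finsetSum _ fun i _ => hint i) hdens hA hL
  have hsum : ∫ z, ∑ i, gaussianLLR σ τ (u i) (z i) ∂(Measure.pi fun _ => complexGaussian σ) ≤
      n * Real.log (1 + S / (2 * σ ^ 2)) := by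
    rw [integral_finsetSum _ fun i _ => hint i]
    refine (Finset.sum_le_card_nsmul _ _ (Real.log (1 + S / (2 * σ ^ 2))) fun i _ => ?_).trans
      (by simp)
    rw [integral_comp_eval (measurable_gaussianLLR σ τ (u i)).aestronglyMeasurable]
    exact integral_gaussianLLR_le hσ hS (hu i)
  -- Undoing the shift removes the codeword from the reference mass of `D`, so these masses can
  -- later be summed over disjoint decoding regions.
  have hD' : (Measure.pi fun i => (complexGaussian τ).map fun y => -u i + y).real
      {z : Fin n → ℂ | (fun i => u i + z i) ∈ D} =
      (Measure.pi fun _ : Fin n => complexGaussian τ).real D := by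
    rw [hmap, map_measureReal_apply (measurable_pi_lambda _ fun i => by fun_prop) hA]
    congr 1
    ext y
    simp
  rw [hD'] at h
  linarith

lemma norm_extendZero_sq_le {n : ℕ} {x : Fin n → ℂ} {P : ℝ} (hP : 0 ≤ P)
    (hx : ∀ i, ‖x i‖ ^ 2 ≤ P) (j : ℤ) : ‖extendZero x j‖ ^ 2 ≤ P := by
  unfold extendZero
  split_ifs
  · exact hx _
  · simpa using hP

lemma norm_mul_one_add_I_mul_sq (x : ℂ) (t : ℝ) :
    ‖x * (1 + Complex.I * (t : ℂ))‖ ^ 2 = ‖x‖ ^ 2 * (1 + t ^ 2) := by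
  have h : ‖1 + Complex.I * (t : ℂ)‖ ^ 2 = 1 + t ^ 2 := by
    rw [← Complex.normSq_eq_norm_sq, Complex.normSq_apply]
    simp
    ring
  rw [norm_mul, mul_pow, h]

/-! ### Averaging over messages and passage to rates. -/

/-- The sum over all tuples of a function of one coordinate. -/
lemma sum_pi_eval_mul_card {ι : Type*} [Fintype ι] [DecidableEq ι] {β : ι → Type*}
    [∀ i, Fintype (β i)] (k : ι) (f : β k → ℝ) :
    (∑ m : (∀ i, β i), f (m k)) * Fintype.card (β k) =
      Fintype.card (∀ i, β i) * ∑ a, f a := by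
  rw [Fintype.card_congr (Equiv.piSplitAt k β), Fintype.card_prod,
    ← Equiv.sum_comp (Equiv.piSplitAt k β).symm, Fintype.sum_prod_type]
  simp only [Equiv.piSplitAt_symm_apply, dite_true, Finset.sum_const, Finset.card_univ,
    nsmul_eq_mul, ← Finset.mul_sum]
  push_cast
  ring

/-- If `L` messages can be sent over `n` channel uses with error probability `e n → 0` and
`(1 - e n) * log L ≤ n * C + 1`, then the rate is at most `C`. -/
lemma rate_le_of_one_sub_mul_log_le {R C : ℝ} (hR : 0 ≤ R) {e : ℕ → ℝ}
    (he : Tendsto e atTop (𝓝 0))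
    (h : ∀ n : ℕ, (1 - e n) * Real.log ⌊(2 : ℝ) ^ ((n : ℝ) * R)⌋₊ ≤ n * C + 1) :
    R * Real.log 2 ≤ C := by
  have hinv : Tendsto (fun n : ℕ => ((n : ℝ))⁻¹) atTop (𝓝 0) := tendsto_inv_atTop_nhds_zero_nat
  have h1 : Tendsto (fun n : ℕ => (1 - e n) * (R * Real.log 2 - Real.log 2 * (n : ℝ)⁻¹)) atTop
      (𝓝 ((1 - 0) * (R * Real.log 2 - Real.log 2 * 0))) :=
    (tendsto_const_nhds.sub he).mul (tendsto_const_nhds.sub (hinv.const_mul _))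
  have h2 : Tendsto (fun n : ℕ => C + (n : ℝ)⁻¹) atTop (𝓝 (C + 0)) := tendsto_const_nhds.add hinv
  have hle := le_of_tendsto_of_tendsto h1 h2 ?_
  · linarith
  filter_upwards [he.eventually_lt_const one_pos, eventually_gt_atTop 0] with n hen hn
  have hn' : (0 : ℝ) < n := by exact_mod_cast hn
  set x : ℝ := (2 : ℝ) ^ ((n : ℝ) * R) with hx
  have hx1 : 1 ≤ x := Real.one_le_rpow (by norm_num) (by positivity)
  have hfl : 1 ≤ ⌊x⌋₊ := Nat.le_floor (by simpa using hx1)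
  have hfl' : (1 : ℝ) ≤ ⌊x⌋₊ := by exact_mod_cast hfl
  -- Rounding costs at most a factor `2` because `x < ⌊x⌋₊ + 1 ≤ 2 ⌊x⌋₊`; the resulting `log 2`
  -- vanishes after division by `n`.
  have hhalf : x / 2 ≤ ⌊x⌋₊ := by linarith [Nat.lt_floor_add_one x]
  have hlog : n * R * Real.log 2 - Real.log 2 ≤ Real.log ⌊x⌋₊ := by
    rw [← Real.log_rpow two_pos, ← hx, ← Real.log_div (by positivity) two_ne_zero]
    exact Real.log_le_log (by positivity) hhalf
  have hmul := (mul_le_mul_of_nonneg_left hlog (sub_nonneg.2 hen.le)).trans (h n)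
  have hdiv := mul_le_mul_of_nonneg_right hmul (inv_nonneg.2 hn'.le)
  calc (1 - e n) * (R * Real.log 2 - Real.log 2 * (n : ℝ)⁻¹)
      = (1 - e n) * (n * R * Real.log 2 - Real.log 2) * (n : ℝ)⁻¹ := by field_simp
    _ ≤ (n * C + 1) * (n : ℝ)⁻¹ := hdiv
    _ = C + (n : ℝ)⁻¹ := by field_simp

/-! ### The XPM channel: received power and the outer bound. -/

namespace XPMChannel

variable {K : ℕ} (ch : XPMChannel K)

/-- The largest interference power that user `k` can see. -/
def maxInterference (k : Fin K) : ℝ :=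
  ∑ w ∈ Finset.univ.erase k, ch.P w * ∑ m ∈ Finset.Icc (-(ch.M : ℤ)) ch.M, ch.c k w m

/-- The largest noiseless power that user `k` can receive. -/
def maxReceivedPower (k : Fin K) : ℝ :=
  ch.P k * (1 + ch.maxInterference k ^ 2)

variable {ch}

lemma maxReceivedPower_nonneg (hP : ∀ k, 0 ≤ ch.P k) (k : Fin K) : 0 ≤ ch.maxReceivedPower k :=
  mul_nonneg (hP k) (by positivity)

lemma interference_nonneg
    (hc : ∀ k w, w ≠ k → ∀ m ∈ Finset.Icc (-(ch.M : ℤ)) ch.M, 0 ≤ ch.c k w m)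
    {n : ℕ} (x : Fin K → Fin n → ℂ) (k : Fin K) (i : Fin n) : 0 ≤ ch.interference x k i :=
  Finset.sum_nonneg fun m hm => Finset.sum_nonneg fun w hw =>
    mul_nonneg (hc k w (Finset.ne_of_mem_erase hw) m hm) (by positivity)

lemma interference_le_maxInterference (hP : ∀ k, 0 ≤ ch.P k)
    (hc : ∀ k w, w ≠ k → ∀ m ∈ Finset.Icc (-(ch.M : ℤ)) ch.M, 0 ≤ ch.c k w m)
    {n : ℕ} {x : Fin K → Fin n → ℂ} (hx : ∀ k i, ‖x k i‖ ^ 2 ≤ ch.P k) (k : Fin K) (i : Fin n) :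
    ch.interference x k i ≤ ch.maxInterference k := by
  unfold interference maxInterference
  rw [Finset.sum_comm]
  refine Finset.sum_le_sum fun w hw => ?_
  rw [Finset.mul_sum]
  refine Finset.sum_le_sum fun m hm => ?_
  rw [mul_comm (ch.P w)]
  exact mul_le_mul_of_nonneg_left (norm_extendZero_sq_le (hP w) (hx w) _)
    (hc k w (Finset.ne_of_mem_erase hw) m hm)

/-- The interference enters in quadrature, so only its square matters; its nonnegativity is what
lets the upper bound on it be squared. -/
lemma noiseless_power_le (hP : ∀ k, 0 ≤ ch.P k)
    (hc : ∀ k w, w ≠ k → ∀ m ∈ Finset.Icc (-(ch.M : ℤ)) ch.M, 0 ≤ ch.c k w m)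
    {n : ℕ} {x : Fin K → Fin n → ℂ} (hx : ∀ k i, ‖x k i‖ ^ 2 ≤ ch.P k) (k : Fin K) (i : Fin n) :
    ‖x k i * (1 + Complex.I * (ch.interference x k i : ℂ))‖ ^ 2 ≤ ch.maxReceivedPower k := by
  rw [norm_mul_one_add_I_mul_sq]
  have h0 := interference_nonneg hc x k i
  have h1 := interference_le_maxInterference hP hc hx k i
  unfold maxReceivedPower
  gcongr
  · exact hP k
  · exact hx k i

lemma upperBound_eq (k : Fin K) : ch.upperBound k =
    Real.log (1 + ch.maxReceivedPower k / (2 * ch.σ k ^ 2)) / Real.log 2 := by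
  rw [upperBound, Real.logb, maxReceivedPower, maxInterference, div_mul_eq_mul_div]

/-- The bound on the size of the message set of user `k` for a fixed tuple of messages. -/
lemma Code.one_sub_errorProb_mul_log_le (hP : ∀ k, 0 ≤ ch.P k) (hσ : ∀ k, 0 < ch.σ k)
    (hc : ∀ k w, w ≠ k → ∀ m ∈ Finset.Icc (-(ch.M : ℤ)) ch.M, 0 ≤ ch.c k w m)
    {n : ℕ} {L : Fin K → ℕ} (C : ch.Code n L) {ν : Measure (Fin K → Fin n → ℂ)}
    [IsProbabilityMeasure ν] {k : Fin K}
    (hν : ν.map (fun z => z k) = Measure.pi (fun _ : Fin n => complexGaussian (ch.σ k)))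
    (hL : 1 ≤ L k) (m : ∀ k, Fin (L k)) :
    (1 - ν.real {z | ∃ k, C.decode k (ch.output (C.input m) z k) ≠ some (m k)}) *
        Real.log (L k) ≤
      n * Real.log (1 + ch.maxReceivedPower k / (2 * ch.σ k ^ 2)) + (L k - 1) *
        (Measure.pi fun _ : Fin n =>
          complexGaussian √(ch.σ k ^ 2 + ch.maxReceivedPower k / 2)).real
            {y | C.decode k y = some (m k)} := by
  have hL' : (1 : ℝ) ≤ L k := by exact_mod_cast hL
  set u : Fin n → ℂ := fun i =>
    C.input m k i * (1 + Complex.I * (ch.interference (C.input m) k i : ℂ))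
  have hD := C.measurable_decode k (m k)
  have hA : MeasurableSet {z : Fin n → ℂ | (fun i => u i + z i) ∈ {y | C.decode k y = some (m k)}} :=
    (measurable_pi_lambda _ fun i => by fun_prop) hD
  refine le_trans (mul_le_mul_of_nonneg_right ?_ (Real.log_nonneg hL'))
    (gaussian_codeword_bound (hσ k) (maxReceivedPower_nonneg hP k)
      (u := u) (fun i => noiseless_power_le (x := C.input m) hP hc
        (fun w => C.peak_power w (m w)) k i) hD hL')
  -- Correct decoding by user `k` depends on the noise only through `z k`, so the marginal law
  -- suffices and dependence between users is irrelevant. Its failure lies in the joint error event.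
  rw [← hν, map_measureReal_apply (measurable_pi_apply k) hA, sub_le_iff_le_add,
    ← probReal_univ (μ := ν), ← measureReal_add_measureReal_compl ((measurable_pi_apply k) hA)]
  have hsub : ((fun z : Fin K → Fin n → ℂ => z k) ⁻¹'
      {z | (fun i => u i + z i) ∈ {y | C.decode k y = some (m k)}})ᶜ ⊆
      {z | ∃ k, C.decode k (ch.output (C.input m) z k) ≠ some (m k)} := fun z hz => ⟨k, hz⟩
  linarith [measureReal_mono (μ := ν) hsub]

/-- Averaged over message tuples, the reference mass of user `k`'s decoding region is at most `1 / L
k`, by disjointness. Hence the term with factor `L k - 1` contributes at most `1`. -/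
lemma Code.one_sub_errorProb_mul_log_card_le (hP : ∀ k, 0 ≤ ch.P k) (hσ : ∀ k, 0 < ch.σ k)
    (hc : ∀ k w, w ≠ k → ∀ m ∈ Finset.Icc (-(ch.M : ℤ)) ch.M, 0 ≤ ch.c k w m)
    {n : ℕ} {L : Fin K → ℕ} (hL : ∀ k, 1 ≤ L k) (C : ch.Code n L)
    {ν : Measure (Fin K → Fin n → ℂ)} [IsProbabilityMeasure ν] {k : Fin K}
    (hν : ν.map (fun z => z k) = Measure.pi (fun _ : Fin n => complexGaussian (ch.σ k))) :
    (1 - C.errorProb ν) * Real.log (L k) ≤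
      n * Real.log (1 + ch.maxReceivedPower k / (2 * ch.σ k ^ 2)) + 1 := by
  have hL' : (1 : ℝ) ≤ L k := by exact_mod_cast hL k
  set γ := Measure.pi fun _ : Fin n =>
    complexGaussian √(ch.σ k ^ 2 + ch.maxReceivedPower k / 2)
  set N : ℝ := (Fintype.card (∀ k, Fin (L k)) : ℝ) with hNdef
  have hN : 0 < N := by
    have : Nonempty (∀ k, Fin (L k)) := ⟨fun k => ⟨0, hL k⟩⟩
    exact Nat.cast_pos.2 Fintype.card_pos
  have hdisj : ∑ a : Fin (L k), γ.real {y | C.decode k y = some a} ≤ 1 := by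
    rw [← measureReal_iUnion_fintype]
    · exact measureReal_le_one
    · intro a b hab
      refine Set.disjoint_left.2 fun y ha hb => hab ?_
      simp only [Set.mem_ofPred_eq] at ha hb
      exact Option.some_injective _ (ha.symm.trans hb)
    · exact fun a => C.measurable_decode k a
  have hγ : (∑ m : (∀ k, Fin (L k)), γ.real {y | C.decode k y = some (m k)}) * L k ≤ N := by
    have h := sum_pi_eval_mul_card (β := fun k => Fin (L k)) k
      fun a => γ.real {y | C.decode k y = some a}
    rw [Fintype.card_fin] at h
    rw [h]
    exact mul_le_of_le_one_right hN.le hdisj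
  have hγ' : (L k - 1) * ∑ m : (∀ k, Fin (L k)), γ.real {y | C.decode k y = some (m k)} ≤ N := by
    have : 0 ≤ ∑ m : (∀ k, Fin (L k)), γ.real {y | C.decode k y = some (m k)} :=
      Finset.sum_nonneg fun m _ => measureReal_nonneg
    linarith
  have hsum := Finset.sum_le_sum fun (m : ∀ k, Fin (L k)) (_ : m ∈ Finset.univ) =>
    C.one_sub_errorProb_mul_log_le hP hσ hc hν (hL k) m
  rw [← Finset.sum_mul, Finset.sum_sub_distrib, Finset.sum_add_distrib] at hsum
  simp only [Finset.sum_const, Finset.card_univ, nsmul_eq_mul, mul_one, ← hNdef,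
    ← Finset.mul_sum] at hsum
  unfold Code.errorProb
  rw [← hNdef, ← mul_le_mul_iff_right₀ hN, ← mul_assoc, mul_sub, mul_div_cancel₀ _ hN.ne']
  linarith

lemma Achievable.le_upperBound (hP : ∀ k, 0 ≤ ch.P k) (hσ : ∀ k, 0 < ch.σ k)
    (hc : ∀ k w, w ≠ k → ∀ m ∈ Finset.Icc (-(ch.M : ℤ)) ch.M, 0 ≤ ch.c k w m)
    {N : ∀ n : ℕ, Measure (Fin K → Fin n → ℂ)} (hN : IsGaussianNoise ch.σ N) {R : Fin K → ℝ}
    (hR : ch.Achievable N R) (k : Fin K) : R k ≤ ch.upperBound k := by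
  obtain ⟨hR0, C, hC⟩ := hR
  rw [upperBound_eq, le_div_iff₀ (Real.log_pos one_lt_two)]
  refine rate_le_of_one_sub_mul_log_le (hR0 k) hC fun n => ?_
  have := (hN n).1
  refine (C n).one_sub_errorProb_mul_log_card_le hP hσ hc (fun j => Nat.le_floor ?_) ((hN n).2 k)
  simpa using Real.one_le_rpow one_le_two (mul_nonneg n.cast_nonneg (hR0 j))

lemma isClosed_outerRegion : IsClosed ch.outerRegion := by
  simp only [outerRegion, Set.ofPred_forall]
  exact isClosed_iInter fun k => isClosed_le (continuous_apply k) continuous_const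

end XPMChannel

theorem theorem1 {K : ℕ} (ch : XPMChannel K)
    (hP : ∀ k, 0 ≤ ch.P k) (hσ : ∀ k, 0 < ch.σ k)
    (hc : ∀ k w, w ≠ k → ∀ m ∈ Finset.Icc (-(ch.M : ℤ)) ch.M, 0 ≤ ch.c k w m)
    (N : ∀ n : ℕ, Measure (Fin K → Fin n → ℂ)) (hN : IsGaussianNoise ch.σ N) :
    ch.IsOuterBound N ch.outerRegion ∧ ch.capacityRegion N ⊆ ch.outerRegion := by
  have h : ch.IsOuterBound N ch.outerRegion := fun R hR k => hR.le_upperBound hP hσ hc hN k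
  exact ⟨h, closure_minimal h XPMChannel.isClosed_outerRegion⟩

end
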